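/- Let $k$ be a field and let $\mathcal T$ be a $k$-linear, Hom-finite, Krull–Schmidt triangulated category with shift $\Sigma$. Let $(\mathcal T,\mathcal T^p,\mathbb S,\mathcal S)$ be a simple minded collection (SMC) quadruple over $k$. This means the following. (RS0) $\mathcal T^p\subseteq\mathcal T$ is a thick subcategory. (RS1) $\mathbb S:\mathcal T\to\mathcal T$ is a triangle equivalence restricting to an equivalence $\mathcal T^p\to\mathcal T^p$, and there is a bifunctorial isomorphism $D\,\mathcal T(X,Y)\cong\mathcal T(Y,\mathbb S X)$ for $X\in\mathcal T^p$, $Y\in\mathcal T$, where $D=\mathrm{Hom}_k(-,k)$. (RS2) $\mathcal S$ is a simple minded collection: for $X,Y\in\mathcal S$ one has $\mathcal T(X,\Sigma^{n}Y)=0$ for all $n<0$, one has $\dim_k\mathcal T(X,Y)=1$ if $X\cong Y$ and $\dim_k\mathcal T(X,Y)=0$ otherwise, and $\mathrm{thick}(\mathcal S)=\mathcal T$. Moreover $({}^\perp(\Sigma^{\ge0}\mathcal S),{}^\perp(\Sigma^{<0}\mathcal S))$ and $((\Sigma^{\ge0}\mathcal S)^\perp,(\Sigma^{<0}\mathcal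 S)^\perp)$ are co-$t$-structures on $\mathcal T$, with ${}^\perp(\Sigma^{\ge0}\mathcal S)\subseteq\mathcal T^p$ and $(\Sigma^{<0}\mathcal S)^\perp\subseteq\mathcal T^p$. (A co-$t$-structure is a pair $(\mathcal A,\mathcal B)$ of full subcategories with $\mathcal A={}^\perp\mathcal B$, $\mathcal B=\mathcal A^\perp$, $\Sigma^{-1}\mathcal A\subseteq\mathcal A$, $\Sigma\mathcal B\subseteq\mathcal B$, such that every object $X$ of $\mathcal T$ lies in a triangle $A\to X\to B\to\Sigma A$ with $A\in\mathcal A$, $B\in\mathcal B$.) For $i\in\mathbb Z$ put $\mathcal T_{>i}={}^\perp(\Sigma^{>-i-1}\mathcal S)$ and $\mathcal T_{\le i}={}^\perp(\Sigma^{<-i}\mathcal S)$. A truncation triangle of $X$ at $i$ is a triangle $X_{>i}\to X\xrightarrow{g_i}X_{\le i}\xrightarrow{h_i}\Sigma X_{>i}$ with $X_{>i}\in\mathcal T_{>i}$ and $X_{\le i}\in\mathcal T_{\le i}$. By a truncation system of $X$ we mean a choice of truncation triangles of $X$ at $i=0,-1,-2,\dots$ together with morphisms of triangles, equal to $\mathrm{id}_X$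 on the middle term, from the triangle at $i$ to the one at $i-1$; it yields direct systems $X\to X_{\le0}\to X_{\le-1}\to\cdots$ and $\Sigma X_{>0}\to\Sigma X_{>-1}\to\cdots$. Let $Q:\mathcal T\to\mathcal T/\mathcal T^p$ be the Verdier quotient functor. Let $X,Y$ be objects of $\mathcal T$. (a) There is an integer $N\ge0$ such that, for every truncation system of $X$ and every $p\ge N$, the map $\mathcal T(Y,X_{\le-p})\to\mathcal T(Y,X_{\le-p-1})$ is bijective; that is, each direct system $$\mathcal T(Y,X)\to\mathcal T(Y,X_{\le0})\to\mathcal T(Y,X_{\le-1})\to\cdots$$ stabilizes. Moreover, for every truncation system of $X$ there is a $k$-linear isomorphism $$\varinjlim_p\mathcal T(Y,X_{\le-p})\cong\mathcal T/\mathcal T^p(Y,X),$$ sending the class of $\varphi:Y\to X_{\le-p}$ to the morphism $\theta$ with $Q(g_{-p})\circ\theta=Q(\varphi)$. (b) For all truncation systems of $Y$ and of $X$ there is a $k$-linear isomorphism $$\mathcal T/\mathcal T^p(Y,X)\cong\varprojlim_q\Big(\varinjlim_p\mathcal T(Y_{\le-q},\Sigma X_{>-p})\Big),$$ such that, whenever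 $Q(g_{-p}^X)\circ\theta=Q(\psi\circ g_{-q}^Y)$ for some $\psi:Y_{\le-q}\to X_{\le-p}$, the $q$-th component of the image of $\theta$ is the class of $h_{-p}^X\circ\psi$. -/

import Mathlib

open CategoryTheory CategoryTheory.Limits CategoryTheory.Pretriangulated

noncomputable section

namespace SMCQuadruple

universe w v u

section Basic

variable {T : Type u} [Category.{v} T] [Preadditive T] [HasZeroObject T] [HasShift T ℤ]
  [∀ n : ℤ, (shiftFunctor T n).Additive] [Pretriangulated T]

/-- The objects isomorphic to `Σⁿ s` with `s` in `S` and `n ∈ I`. -/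
def shiftsIn (S : ObjectProperty T) (I : Set ℤ) : ObjectProperty T :=
  fun Z => ∃ n ∈ I, ∃ s : T, S s ∧ Nonempty (Z ≅ s⟦n⟧)

/-- `T = A ⊥ B` is a torsion pair: `A = {}^⊥ B`, `B = A^⊥` and `T = A * B`. -/
structure IsTorsionPair (A B : ObjectProperty T) : Prop where
  left_eq : A = B.leftOrthogonal
  right_eq : B = A.rightOrthogonal
  exists_triangle : ∀ X : T, ∃ (U V : T) (f : U ⟶ X) (g : X ⟶ V) (h : V ⟶ U⟦(1 : ℤ)⟧),
    A U ∧ B V ∧ Triangle.mk f g h ∈ distTriang T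

/-- A co-t-structure `T = A ⊥ B`: a torsion pair with `Σ⁻¹ A ⊆ A` and `Σ B ⊆ B`. -/
structure IsCoTStructure (A B : ObjectProperty T) : Prop extends IsTorsionPair A B where
  left_shift : ∀ X : T, A X → A (X⟦(-1 : ℤ)⟧)
  right_shift : ∀ X : T, B X → B (X⟦(1 : ℤ)⟧)

/-- `thick(S) = T`: every thick (triangulated, closed under direct summands) full subcategory
containing `S` is all of `T`. -/
def ThickGenerates (S : ObjectProperty T) : Prop :=
  ∀ Q : ObjectProperty T, Q.IsTriangulated → Q.IsStableUnderRetracts → S ≤ Q → ∀ X : T, Q X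

/-- Every object is a finite direct sum of objects with local endomorphism rings. -/
def IsKrullSchmidt (T : Type u) [Category.{v} T] [Preadditive T] : Prop :=
  ∀ X : T, ∃ (n : ℕ) (Z : Fin n → T) (b : Bicone Z),
    Nonempty b.IsBilimit ∧ Nonempty (X ≅ b.pt) ∧ ∀ i, IsLocalRing (End (Z i))

/-- `T_{>i} = {}^⊥ (Σ^{>-i-1} S)`. -/
def TGt (S : ObjectProperty T) (i : ℤ) : ObjectProperty T :=
  (shiftsIn S {n | n > -i - 1}).leftOrthogonal

/-- `T_{≤i} = {}^⊥ (Σ^{<-i} S)`. -/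
def TLe (S : ObjectProperty T) (i : ℤ) : ObjectProperty T :=
  (shiftsIn S {n | n < -i}).leftOrthogonal

/-- A fixed choice of truncation triangles `X_{>-p} ⟶ X ⟶ X_{≤-p} ⟶ Σ X_{>-p}`, `p = 0, 1, 2, …`,
together with morphisms of triangles (with identity middle component) from each one to the next.
Here `gt p = X_{>-p}` and `le p = X_{≤-p}`. -/
structure TruncationSystem (S : ObjectProperty T) (X : T) where
  gt : ℕ → T
  le : ℕ → T
  f : ∀ p, gt p ⟶ X
  g : ∀ p, X ⟶ le p
  h : ∀ p, le p ⟶ (gt p)⟦(1 : ℤ)⟧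
  gt_mem : ∀ p : ℕ, TGt S (-(p : ℤ)) (gt p)
  le_mem : ∀ p : ℕ, TLe S (-(p : ℤ)) (le p)
  distinguished : ∀ p, Triangle.mk (f p) (g p) (h p) ∈ distTriang T
  α : ∀ p, gt p ⟶ gt (p + 1)
  ξ : ∀ p, le p ⟶ le (p + 1)
  α_f : ∀ p, α p ≫ f (p + 1) = f p
  g_ξ : ∀ p, g p ≫ ξ p = g (p + 1)
  ξ_h : ∀ p, ξ p ≫ h (p + 1) = h p ≫ (α p)⟦(1 : ℤ)⟧'

namespace TruncationSystem

variable {S : ObjectProperty T} {X : T} (t : TruncationSystem S X)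

/-- The direct system `X_{≤0} ⟶ X_{≤-1} ⟶ X_{≤-2} ⟶ ⋯`. -/
def leSystem : ℕ ⥤ T := Functor.ofSequence t.ξ

/-- The direct system `Σ X_{>0} ⟶ Σ X_{>-1} ⟶ Σ X_{>-2} ⟶ ⋯`. -/
def shiftGtSystem : ℕ ⥤ T := Functor.ofSequence t.α ⋙ shiftFunctor T (1 : ℤ)

end TruncationSystem

end Basic

section Colimits

variable (k : Type w) [Field k] {T : Type u} [Category.{v} T] [Preadditive T] [Linear k T]

/-- `colim_p T(Y, F p)`, for a direct system `F` in `T`. -/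
abbrev HomColim (Y : T) (F : ℕ ⥤ T) : Type v :=
  Module.DirectLimit (R := k) (fun p => Y ⟶ F.obj p)
    (fun _ _ hij => Linear.rightComp k Y (F.map (homOfLE hij)))

/-- The structure map `T(Y, F p) → colim_p T(Y, F p)`. -/
def HomColim.ι (Y : T) (F : ℕ ⥤ T) (p : ℕ) : (Y ⟶ F.obj p) →ₗ[k] HomColim k Y F :=
  Module.DirectLimit.of k ℕ (fun p => Y ⟶ F.obj p)
    (fun _ _ hij => Linear.rightComp k Y (F.map (homOfLE hij))) p

/-- The map `colim_p T(Y', F p) → colim_p T(Y, F p)` induced by `u : Y ⟶ Y'`. -/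
def HomColim.precomp {Y Y' : T} (u : Y ⟶ Y') (F : ℕ ⥤ T) :
    HomColim k Y' F →ₗ[k] HomColim k Y F :=
  Module.DirectLimit.map (fun p => Linear.leftComp k (F.obj p) u) (by
    intro i j hij
    ext φ
    simp)

/-- `lim_q (colim_p T(G q, F p))`, for direct systems `G`, `F` in `T`: the compatible families
inside the product over `q`. -/
def HomLimColim (G F : ℕ ⥤ T) : Submodule k (∀ q : ℕ, HomColim k (G.obj q) F) where
  carrier := {x | ∀ (i j : ℕ) (hij : i ≤ j),
    HomColim.precomp k (G.map (homOfLE hij)) F (x j) = x i}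
  add_mem' := by
    intro x y hx hy i j hij
    simp only [Pi.add_apply, map_add, hx i j hij, hy i j hij]
  zero_mem' := by
    intro i j hij
    simp
  smul_mem' := by
    intro c x hx i j hij
    simp only [Pi.smul_apply, map_smul, hx i j hij]

end Colimits

section Quadruple

variable (k : Type w) [Field k] {T : Type u} [Category.{v} T] [Preadditive T] [Linear k T]
  [HasZeroObject T] [HasShift T ℤ] [∀ n : ℤ, (shiftFunctor T n).Additive] [Pretriangulated T]

/-- `S` is a simple minded collection in `T` (its members being counted up to isomorphism). -/
structure IsSimpleMindedCollection (S : ObjectProperty T) : Prop where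
  hom_shift_neg : ∀ X Y : T, S X → S Y → ∀ n : ℤ, n < 0 → ∀ φ : X ⟶ Y⟦n⟧, φ = 0
  finrank_hom_of_iso : ∀ X Y : T, S X → S Y → Nonempty (X ≅ Y) →
    Module.finrank k (X ⟶ Y) = 1
  finrank_hom_of_not_iso : ∀ X Y : T, S X → S Y → IsEmpty (X ≅ Y) →
    Module.finrank k (X ⟶ Y) = 0
  thick_eq : ThickGenerates S

/-- The bifunctorial isomorphism `D T(X, Y) ≅ T(Y, 𝕊 X)` for `X ∈ P` and `Y ∈ T`. -/
def HasRelativeSerreDuality (P : ObjectProperty T) (𝕊 : T ⥤ T) : Prop :=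
  ∃ e : ∀ X Y : T, P X → (Module.Dual k (X ⟶ Y) ≃ₗ[k] (Y ⟶ 𝕊.obj X)),
    ∀ (X X' Y Y' : T) (hX : P X) (hX' : P X') (f : X ⟶ X') (g : Y' ⟶ Y)
      (l : Module.Dual k (X ⟶ Y)),
      e X' Y' hX' (l ∘ₗ Linear.leftComp k Y f ∘ₗ Linear.rightComp k X' g) =
        g ≫ e X Y hX l ≫ 𝕊.map f

/-- `(T, P, 𝕊, S)` is an SMC quadruple over `k`, where `P` is the thick subcategory `T^p`. -/
structure IsSMCQuadruple (P : ObjectProperty T) (𝕊 : T ⥤ T) [𝕊.CommShift ℤ]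
    (S : ObjectProperty T) : Prop where
  hom_finite : ∀ X Y : T, Module.Finite k (X ⟶ Y)
  krullSchmidt : IsKrullSchmidt T
  isTriangulated : P.IsTriangulated
  isStableUnderRetracts : P.IsStableUnderRetracts
  serre_isTriangulated : 𝕊.IsTriangulated
  serre_isEquivalence : 𝕊.IsEquivalence
  serre_restricts : ∃ hP : ∀ X : T, P X → P (𝕊.obj X),
    (P.lift (P.ι ⋙ 𝕊) (fun X => hP X.obj X.property)).IsEquivalence
  duality : HasRelativeSerreDuality k P 𝕊
  smc : IsSimpleMindedCollection k S
  left_coT : IsCoTStructure (shiftsIn S {n | n ≥ 0}).leftOrthogonal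
    (shiftsIn S {n | n < 0}).leftOrthogonal
  right_coT : IsCoTStructure (shiftsIn S {n | n ≥ 0}).rightOrthogonal
    (shiftsIn S {n | n < 0}).rightOrthogonal
  left_le : (shiftsIn S {n | n ≥ 0}).leftOrthogonal ≤ P
  right_le : (shiftsIn S {n | n < 0}).rightOrthogonal ≤ P

end Quadruple

end SMCQuadruple

end

open CategoryTheory CategoryTheory.Limits CategoryTheory.Pretriangulated

noncomputable section

namespace SMCQuadruple

universe w v u

/-! ### Shifting orthogonals of the simple minded collection. -/

section Shift

variable {T : Type u} [Category.{v} T] [Preadditive T] [HasShift T ℤ]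

/-! Everything follows from one vanishing: for each `W`, deep objects `C` in `T_{≤-p}`, `p ≫ 0`,
have no nonzero map to `W`. The `W` with this property form a thick subcategory containing `S`,
hence all of `T`. Relative Serre duality turns this into vanishing of maps from a perfect object to
deep objects, and of maps from any object to deep perfect ones.

Stabilization: the cone of `X_{≤-p} ⟶ X_{≤-p-1}` is perfect and deep, so it is invisible to `Y`.
Colimit: a map out of the source of any `s` with perfect cone extends along `s` once its target is
deep, so the maps `g p` absorb all fractions. Limit: for `q ≫ 0`, `Y_{≤-q}` has no maps to `X` or
`ΣX`, so composing with `h p` is bijective; replacing `Y` by `Y_{≤-q}`, which is isomorphic to it in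
the quotient, makes every late term of the inverse system a copy of the quotient Hom-space. -/

lemma TLe.mono {S : ObjectProperty T} {i j : ℤ} {C : T} (hC : TLe S i C) (h : i ≤ j) :
    TLe S j C := by
  rintro Z φ ⟨m, hm, s, hs, he⟩
  exact hC φ ⟨m, lt_of_lt_of_le (show m < -j from hm) (show -j ≤ -i by lia), s, hs, he⟩

variable [∀ n : ℤ, (shiftFunctor T n).Additive]

lemma eq_zero_of_shift_left {A B : T} {n m : ℤ} (hnm : n + m = 0)
    (h : ∀ φ : A ⟶ B⟦m⟧, φ = 0) (φ : A⟦n⟧ ⟶ B) : φ = 0 := by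
  apply (shiftFunctor T m).map_injective
  rw [Functor.map_zero, ← cancel_epi ((shiftFunctorCompIsoId T n m hnm).inv.app A)]
  exact (h _).trans comp_zero.symm

lemma leftOrthogonal_shiftsIn_shift {S : ObjectProperty T} {I J : Set ℤ} (n : ℤ)
    (hJ : ∀ m ∈ J, m - n ∈ I) {C : T} (hC : (shiftsIn S I).leftOrthogonal C) :
    (shiftsIn S J).leftOrthogonal (C⟦n⟧) := by
  rintro Z φ ⟨m, hm, s, hs, ⟨e⟩⟩
  refine eq_zero_of_shift_left (add_neg_cancel n) (fun ψ => hC ψ ?_) φ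
  exact ⟨m - n, hJ m hm, s, hs,
    ⟨(shiftFunctor T (-n)).mapIso e ≪≫ (shiftFunctorAdd' T m (-n) (m - n) (by lia)).symm.app s⟩⟩

lemma TLe.shift {S : ObjectProperty T} {i : ℤ} {C : T} (hC : TLe S i C) (n j : ℤ)
    (h : j + n = i) : TLe S j (C⟦n⟧) :=
  leftOrthogonal_shiftsIn_shift n (fun m (hm : m < -j) => show m - n < -i by lia) hC

/-- Shifting by `i` moves `C` into the left half of the given co-t-structure, which is perfect. -/
lemma TGt.mem_of_leftOrthogonal_le {S P : ObjectProperty T} [P.IsStableUnderShift ℤ]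
    [P.IsClosedUnderIsomorphisms] (hP : (shiftsIn S {n | n ≥ 0}).leftOrthogonal ≤ P)
    {i : ℤ} {C : T} (hC : TGt S i C) : P C := by
  have h : P (C⟦i⟧) := hP _ (leftOrthogonal_shiftsIn_shift i
    (fun m (hm : m ≥ 0) => show m - i > -i - 1 by lia) hC)
  exact P.prop_of_iso ((shiftFunctorCompIsoId T i (-i) (add_neg_cancel i)).app C)
    (P.le_shift (-i) _ h)

end Shift

/-! ### Every object is eventually right orthogonal to deep truncations. -/

section Orthogonality

variable {T : Type u} [Category.{v} T] [Preadditive T] [HasZeroObject T] [HasShift T ℤ]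
  [∀ n : ℤ, (shiftFunctor T n).Additive] [Pretriangulated T]

lemma TLe.cone {S : ObjectProperty T} {i : ℤ} {A B C : T} {f : A ⟶ B} {g : B ⟶ C}
    {h : C ⟶ A⟦(1 : ℤ)⟧} (hT : Triangle.mk f g h ∈ distTriang T)
    (hA : TLe S (i + 1) A) (hB : TLe S i B) : TLe S i C := by
  intro Z φ hZ
  obtain ⟨ψ, rfl⟩ := Triangle.yoneda_exact₃ _ hT φ (hB _ hZ)
  rw [hA.shift 1 i rfl ψ hZ]
  exact comp_zero

/-- The objects `W` that receive no nonzero morphism from `T_{≤ -N}`, for some `N`. -/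
def EventuallyRightOrthogonal (S : ObjectProperty T) : ObjectProperty T :=
  fun W => ∃ N : ℤ, ∀ C : T, TLe S (-N) C → ∀ φ : C ⟶ W, φ = 0

instance (S : ObjectProperty T) : (EventuallyRightOrthogonal S).IsStableUnderRetracts where
  of_retract := by
    rintro X Y r ⟨N, hN⟩
    refine ⟨N, fun C hC φ => ?_⟩
    rw [← Category.comp_id φ, ← r.retract, ← Category.assoc, hN C hC (φ ≫ r.i), zero_comp]

instance (S : ObjectProperty T) : (EventuallyRightOrthogonal S).IsTriangulated where
  exists_zero := ⟨_, isZero_zero T, (0 : ℤ), fun _ _ φ => (isZero_zero T).eq_zero_of_tgt φ⟩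
  isStableUnderShiftBy n := ⟨by
    rintro W ⟨N, hN⟩
    refine ⟨N + n, fun C hC φ => ?_⟩
    apply (shiftFunctor T (-n)).map_injective
    rw [Functor.map_zero,
      ← cancel_mono ((shiftFunctorCompIsoId T n (-n) (add_neg_cancel n)).hom.app W)]
    exact (hN _ (hC.shift (-n) (-N) (by lia)) _).trans zero_comp.symm⟩
  toIsTriangulatedClosed₂ := .mk' (by
    rintro Δ hΔ ⟨N₁, h₁⟩ ⟨N₃, h₃⟩
    refine ⟨max N₁ N₃, fun C hC φ => ?_⟩
    obtain ⟨ψ, rfl⟩ := Triangle.coyoneda_exact₂ _ hΔ φ (h₃ C (hC.mono (by lia)) _)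
    rw [h₁ C (hC.mono (by lia)) ψ, zero_comp])

lemma eventuallyRightOrthogonal_of_thickGenerates {S : ObjectProperty T} (hS : ThickGenerates S)
    (W : T) : EventuallyRightOrthogonal S W :=
  hS _ inferInstance inferInstance (fun s hs =>
    -- `N = 1` is the first bound for which `Σ⁰ S` is among the shifts killed, since `0 < N` is
    -- needed.
    ⟨1, fun _ hC φ => hC φ ⟨0, by simp, s, hs, ⟨(shiftFunctorZero T ℤ).symm.app s⟩⟩⟩) W

end Orthogonality

/-! ### Vanishing transported through Serre duality. -/

section Vanishing

variable {k : Type w} [Field k] {T : Type u} [Category.{v} T] [Preadditive T] [Linear k T]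

lemma HasRelativeSerreDuality.hom_eq_zero {P : ObjectProperty T} {𝕊 : T ⥤ T}
    (hS : HasRelativeSerreDuality k P 𝕊) {X Y : T} (hX : P X)
    (h : ∀ φ : Y ⟶ 𝕊.obj X, φ = 0) (ψ : X ⟶ Y) : ψ = 0 := by
  obtain ⟨e, -⟩ := hS
  refine (Module.forall_dual_apply_eq_zero_iff k ψ).1 fun l => ?_
  rw [(e X Y hX).map_eq_zero_iff.1 (h (e X Y hX l)), LinearMap.zero_apply]

lemma HasRelativeSerreDuality.hom_serre_eq_zero {P : ObjectProperty T} {𝕊 : T ⥤ T}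
    (hS : HasRelativeSerreDuality k P 𝕊) {X Y : T} (hX : P X)
    (h : ∀ ψ : X ⟶ Y, ψ = 0) (φ : Y ⟶ 𝕊.obj X) : φ = 0 := by
  obtain ⟨e, -⟩ := hS
  obtain ⟨l, rfl⟩ := (e X Y hX).surjective φ
  have : l = 0 := LinearMap.ext fun ψ => by rw [h ψ, map_zero, map_zero]
  rw [this, map_zero]

variable [HasZeroObject T] [HasShift T ℤ] [∀ n : ℤ, (shiftFunctor T n).Additive]
  [Pretriangulated T]

namespace IsSMCQuadruple

variable {P : ObjectProperty T} {𝕊 : T ⥤ T} [𝕊.CommShift ℤ] {S : ObjectProperty T}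

lemma exists_hom_from_TLe_eq_zero (hq : IsSMCQuadruple k P 𝕊 S) (W : T) :
    ∃ N : ℕ, ∀ p : ℕ, N ≤ p → ∀ C : T, TLe S (-(p : ℤ)) C → ∀ φ : C ⟶ W, φ = 0 := by
  obtain ⟨N, hN⟩ := eventuallyRightOrthogonal_of_thickGenerates hq.smc.thick_eq W
  exact ⟨N.toNat, fun p hp C hC => hN C (hC.mono (by lia))⟩

lemma exists_hom_perfect_to_TLe_eq_zero (hq : IsSMCQuadruple k P 𝕊 S) {W : T} (hW : P W) :
    ∃ N : ℕ, ∀ p : ℕ, N ≤ p → ∀ C : T, TLe S (-(p : ℤ)) C → ∀ φ : W ⟶ C, φ = 0 := by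
  obtain ⟨N, hN⟩ := hq.exists_hom_from_TLe_eq_zero (𝕊.obj W)
  exact ⟨N, fun p hp C hC => hq.duality.hom_eq_zero hW (hN p hp C hC)⟩

/-- As `𝕊` restricts to an equivalence on perfect objects, `C ≅ 𝕊 Z` with `Z` perfect. Maps `Y ⟶ 𝕊
Z` are dual to maps `Z ⟶ Y`, which `𝕊` embeds into maps `C ⟶ 𝕊 Y`; these vanish for deep `C`. -/
lemma exists_hom_to_TLe_perfect_eq_zero (hq : IsSMCQuadruple k P 𝕊 S) (Y : T) :
    ∃ N : ℕ, ∀ p : ℕ, N ≤ p → ∀ C : T, TLe S (-(p : ℤ)) C → P C → ∀ φ : Y ⟶ C, φ = 0 := by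
  obtain ⟨N, hN⟩ := hq.exists_hom_from_TLe_eq_zero (𝕊.obj Y)
  refine ⟨N, fun p hp C hC hPC φ => ?_⟩
  obtain ⟨hP, _⟩ := hq.serre_restricts
  have := hq.serre_isEquivalence
  let F := P.lift (P.ι ⋙ 𝕊) (fun X => hP X.obj X.property)
  let Z := F.objPreimage ⟨C, hPC⟩
  let i : 𝕊.obj Z.obj ≅ C := P.ι.mapIso (F.objObjPreimageIso ⟨C, hPC⟩)
  rw [← cancel_mono i.inv, zero_comp]
  refine hq.duality.hom_serre_eq_zero Z.property (fun ψ => 𝕊.map_injective ?_) _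
  rw [Functor.map_zero, ← cancel_epi i.inv, comp_zero]
  exact hN p hp C hC _

end IsSMCQuadruple

end Vanishing

/-! ### Functoriality of Hom-colimits. -/

section HomColim

variable {k : Type w} [Field k] {T : Type u} [Category.{v} T] [Preadditive T] [Linear k T]

namespace HomColim

lemma exists_ι (Y : T) (F : ℕ ⥤ T) (z : HomColim k Y F) :
    ∃ (p : ℕ) (φ : Y ⟶ F.obj p), ι k Y F p φ = z :=
  Module.DirectLimit.exists_of z

lemma ι_comp_map (Y : T) (F : ℕ ⥤ T) {p q : ℕ} (h : p ≤ q) (φ : Y ⟶ F.obj p) :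
    ι k Y F q (φ ≫ F.map (homOfLE h)) = ι k Y F p φ :=
  Module.DirectLimit.of_f (f := fun _ _ hij => Linear.rightComp k Y (F.map (homOfLE hij)))
    (hij := h) (x := φ)

lemma precomp_ι {Y Y' : T} (u : Y ⟶ Y') (F : ℕ ⥤ T) (p : ℕ) (φ : Y' ⟶ F.obj p) :
    precomp k u F (ι k Y' F p φ) = ι k Y F p (u ≫ φ) :=
  Module.DirectLimit.map_apply_of _ _ _

lemma postcomp_compat (Y : T) {F G : ℕ ⥤ T} (η : F ⟶ G) (i j : ℕ) (h : i ≤ j) :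
    Linear.rightComp k Y (η.app j) ∘ₗ Linear.rightComp k Y (F.map (homOfLE h)) =
      Linear.rightComp k Y (G.map (homOfLE h)) ∘ₗ Linear.rightComp k Y (η.app i) := by
  ext φ
  simp

variable (k) in
/-- The map `colim_p T(Y, F p) → colim_p T(Y, G p)` induced by `η : F ⟶ G`. -/
def postcomp (Y : T) {F G : ℕ ⥤ T} (η : F ⟶ G) : HomColim k Y F →ₗ[k] HomColim k Y G :=
  Module.DirectLimit.map (fun p => Linear.rightComp k Y (η.app p)) (postcomp_compat Y η)

lemma postcomp_ι (Y : T) {F G : ℕ ⥤ T} (η : F ⟶ G) (p : ℕ) (φ : Y ⟶ F.obj p) :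
    postcomp k Y η (ι k Y F p φ) = ι k Y G p (φ ≫ η.app p) :=
  Module.DirectLimit.map_apply_of _ _ _

lemma precomp_postcomp {Y Y' : T} (u : Y ⟶ Y') {F G : ℕ ⥤ T} (η : F ⟶ G)
    (z : HomColim k Y' F) :
    precomp k u G (postcomp k Y' η z) = postcomp k Y η (precomp k u F z) := by
  obtain ⟨p, φ, rfl⟩ := exists_ι Y' F z
  rw [postcomp_ι, precomp_ι, precomp_ι, postcomp_ι, Category.assoc]

lemma postcomp_bijective (Y : T) {F G : ℕ ⥤ T} (η : F ⟶ G)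
    (h : ∀ p, Function.Bijective (fun φ : Y ⟶ F.obj p => φ ≫ η.app p)) :
    Function.Bijective (postcomp k Y η) :=
  (Module.DirectLimit.congr
    (fun p => LinearEquiv.ofBijective (Linear.rightComp k Y (η.app p)) (h p))
    (postcomp_compat Y η)).bijective

end HomColim

end HomColim

/-! ### Truncation systems and their comparison with the Verdier quotient. -/

namespace TruncationSystem

section Systems

variable {T : Type u} [Category.{v} T] [Preadditive T] [HasZeroObject T] [HasShift T ℤ]
  [∀ n : ℤ, (shiftFunctor T n).Additive] [Pretriangulated T]
  {S : ObjectProperty T} {X : T} (t : TruncationSystem S X)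

/-- The maps `g p : X ⟶ X_{≤ -p}`, as a cone over the direct system `X_{≤ -p}`. -/
def gNatTrans : (Functor.const ℕ).obj X ⟶ t.leSystem :=
  NatTrans.ofSequence (F := (Functor.const ℕ).obj X) (G := t.leSystem) t.g fun p =>
    (Category.id_comp _).trans ((t.g_ξ p).symm.trans
      (congrArg (t.g p ≫ ·) (Functor.ofSequence_map_homOfLE_succ t.ξ p).symm))

/-- The maps `h p : X_{≤ -p} ⟶ Σ X_{> -p}`, as a morphism of direct systems. -/
def hNatTrans : t.leSystem ⟶ t.shiftGtSystem :=
  NatTrans.ofSequence (F := t.leSystem) (G := t.shiftGtSystem) t.h fun p =>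
    (congrArg (· ≫ t.h (p + 1)) (Functor.ofSequence_map_homOfLE_succ t.ξ p)).trans
      ((t.ξ_h p).trans (congrArg (fun a => t.h p ≫ a⟦(1 : ℤ)⟧')
        (Functor.ofSequence_map_homOfLE_succ t.α p).symm))

/-- The map `g p`, with values in the direct system `X_{≤ -p}`. -/
def toLeSystem (p : ℕ) : X ⟶ t.leSystem.obj p := t.gNatTrans.app p

lemma toLeSystem_map {p q : ℕ} (h : p ≤ q) :
    t.toLeSystem p ≫ t.leSystem.map (homOfLE h) = t.toLeSystem q :=
  (t.gNatTrans.naturality (homOfLE h)).symm.trans (Category.id_comp _)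

lemma leSystem_mem (p : ℕ) : TLe S (-(p : ℤ)) (t.leSystem.obj p) := t.le_mem p

variable (P : ObjectProperty T)

lemma trW_g [P.IsStableUnderShift ℤ] (hP : ∀ p, P (t.gt p)) (p : ℕ) : P.trW (t.toLeSystem p) :=
  ObjectProperty.trW.mk' P (t.distinguished p) (hP p)

lemma exists_cone_ξ [IsTriangulated T] [P.IsTriangulated] [P.IsClosedUnderIsomorphisms]
    (hP : ∀ p, P (t.gt p)) (p : ℕ) :
    ∃ (C : T) (a : t.le (p + 1) ⟶ C) (b : C ⟶ (t.le p)⟦(1 : ℤ)⟧),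
      Triangle.mk (t.ξ p) a b ∈ distTriang T ∧ P C ∧ TLe S (-((p + 1 : ℕ) : ℤ)) C := by
  obtain ⟨C, a, b, hT⟩ := distinguished_cocone_triangle (t.ξ p)
  refine ⟨C, a, b, hT, ?_, ?_⟩
  -- The octahedron on `g p ≫ ξ p = g (p + 1)` puts `C` in a triangle with the perfect objects `Σ
  -- X_{>-p}` and `Σ X_{>-p-1}`.
  · have o := Triangulated.someOctahedron (t.g_ξ p) (rot_of_distTriang _ (t.distinguished p)) hT
      (rot_of_distTriang _ (t.distinguished (p + 1)))
    exact P.ext_of_isTriangulatedClosed₃ _ o.mem (P.le_shift (1 : ℤ) _ (hP p))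
      (P.le_shift (1 : ℤ) _ (hP (p + 1)))
  · exact TLe.cone hT ((t.le_mem p).mono (by lia)) (t.le_mem (p + 1))

end Systems

section Quotient

variable (k : Type w) [Field k] {T : Type u} [Category.{v} T] [Preadditive T] [Linear k T]
  [HasZeroObject T] [HasShift T ℤ] [∀ n : ℤ, (shiftFunctor T n).Additive]
  [Pretriangulated T] {S : ObjectProperty T} {X : T} (t : TruncationSystem S X)
  (P : ObjectProperty T) [P.IsTriangulated] (hP : ∀ p, P (t.gt p))

/-- The isomorphism `X ≅ X_{≤ -p}` in the Verdier quotient. -/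
def quotientIso (p : ℕ) : P.trW.Q.obj X ≅ P.trW.Q.obj (t.leSystem.obj p) :=
  Localization.isoOfHom P.trW.Q P.trW (t.toLeSystem p) (t.trW_g P hP p)

lemma quotientIso_hom (p : ℕ) : (t.quotientIso P hP p).hom = P.trW.Q.map (t.toLeSystem p) := rfl

variable [IsTriangulated T]

/-- The map `colim_p T(Y, X_{≤ -p}) → T/P (Y, X)` sending the class of `φ : Y ⟶ X_{≤ -p}` to
`Q(g p)⁻¹ ∘ Q(φ)`. -/
def toQuotient (Y : T) :
    HomColim k Y t.leSystem →ₗ[k] (P.trW.Q.obj Y ⟶ P.trW.Q.obj X) :=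
  Module.DirectLimit.lift k ℕ _ _
    (fun p => Linear.rightComp k _ (t.quotientIso P hP p).inv ∘ₗ P.trW.Q.mapLinearMap k)
    (fun i j hij φ => by
      change P.trW.Q.map (φ ≫ t.leSystem.map (homOfLE hij)) ≫ (t.quotientIso P hP j).inv =
        P.trW.Q.map φ ≫ (t.quotientIso P hP i).inv
      rw [Iso.comp_inv_eq, Category.assoc, Functor.map_comp]
      congr 1
      rw [Iso.eq_inv_comp, quotientIso_hom, quotientIso_hom, ← Functor.map_comp,
        t.toLeSystem_map])

lemma toQuotient_ι (Y : T) (p : ℕ) (φ : Y ⟶ t.leSystem.obj p) :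
    t.toQuotient k P hP Y (HomColim.ι k Y t.leSystem p φ) =
      P.trW.Q.map φ ≫ (t.quotientIso P hP p).inv :=
  Module.DirectLimit.lift_of _ _ _

lemma toQuotient_precomp {Y Y' : T} (u : Y ⟶ Y') (z : HomColim k Y' t.leSystem) :
    t.toQuotient k P hP Y (HomColim.precomp k u t.leSystem z) =
      P.trW.Q.map u ≫ t.toQuotient k P hP Y' z := by
  obtain ⟨p, φ, rfl⟩ := HomColim.exists_ι Y' _ z
  rw [HomColim.precomp_ι, toQuotient_ι, toQuotient_ι, Functor.map_comp, Category.assoc]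

end Quotient

end TruncationSystem

/-! ### Stabilization, the colimit formula and the limit formula. -/

section Main

variable {k : Type w} [Field k] {T : Type u} [Category.{v} T] [Preadditive T] [Linear k T]
  [HasZeroObject T] [HasShift T ℤ] [∀ n : ℤ, (shiftFunctor T n).Additive]
  [Pretriangulated T]

namespace IsSMCQuadruple

variable {P : ObjectProperty T} {𝕊 : T ⥤ T} [𝕊.CommShift ℤ] {S : ObjectProperty T}

lemma gt_mem_perfect (hq : IsSMCQuadruple k P 𝕊 S) {X : T} (t : TruncationSystem S X) (p : ℕ) :
    P (t.gt p) :=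
  have := hq.isTriangulated
  have := hq.isStableUnderRetracts
  (t.gt_mem p).mem_of_leftOrthogonal_le hq.left_le

lemma exists_bijective_ξ [IsTriangulated T] (hq : IsSMCQuadruple k P 𝕊 S) (X Y : T) :
    ∃ N : ℕ, ∀ (t : TruncationSystem S X) (p : ℕ), N ≤ p →
      Function.Bijective (fun φ : Y ⟶ t.le p => φ ≫ t.ξ p) := by
  have := hq.isTriangulated
  have := hq.isStableUnderRetracts
  obtain ⟨N, hN⟩ := hq.exists_hom_to_TLe_perfect_eq_zero Y
  refine ⟨N, fun t p hp => ?_⟩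
  obtain ⟨C, a, b, hT, hPC, hC⟩ := t.exists_cone_ξ P (hq.gt_mem_perfect t) p
  constructor
  · intro φ φ' h
    rw [← sub_eq_zero]
    have h0 : (φ - φ') ≫ t.ξ p = 0 := by
      rw [Preadditive.sub_comp, sub_eq_zero]
      exact h
    obtain ⟨ψ, hψ⟩ := Triangle.coyoneda_exact₂ _ (inv_rot_of_distTriang _ hT) (φ - φ') h0
    -- Desuspending the cone costs one level: it lies in `T_{≤-p}`, so `p ≥ N` still suffices.
    have : ψ = 0 := hN p hp _ (hC.shift (-1) _ (by lia)) (P.le_shift (-1) _ hPC) ψ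
    exact hψ.trans ((congrArg (· ≫ _) this).trans zero_comp)
  · intro φ
    obtain ⟨ψ, hψ⟩ := Triangle.coyoneda_exact₂ _ hT φ (hN (p + 1) (by lia) C hC hPC _)
    exact ⟨ψ, hψ.symm⟩

/-- The obstruction to extending along `s` is a map from the perfect fibre of `s` to `C`, zero for
deep `C`. -/
lemma exists_factor_of_trW (hq : IsSMCQuadruple k P 𝕊 S) {A Z : T} (s : A ⟶ Z) (hs : P.trW s) :
    ∃ N : ℕ, ∀ p : ℕ, N ≤ p → ∀ C : T, TLe S (-(p : ℤ)) C → ∀ a : A ⟶ C,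
      ∃ b : Z ⟶ C, a = s ≫ b := by
  have := hq.isTriangulated
  obtain ⟨W, f, h, hT, hW⟩ := (P.trW_iff' s).1 hs
  obtain ⟨N, hN⟩ := hq.exists_hom_perfect_to_TLe_eq_zero hW
  exact ⟨N, fun p hp C hC a => Triangle.yoneda_exact₂ _ hT a (hN p hp C hC _)⟩

/-- The bound only has to kill maps from `C` to `X` and `ΣX`, so it is uniform in `p` and in the
truncation system. -/
lemma exists_comp_h_bijective (hq : IsSMCQuadruple k P 𝕊 S) (X : T) :
    ∃ N : ℕ, ∀ q : ℕ, N ≤ q → ∀ C : T, TLe S (-(q : ℤ)) C → ∀ (t : TruncationSystem S X) (p : ℕ),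
      Function.Bijective (fun φ : C ⟶ t.le p => φ ≫ t.h p) := by
  obtain ⟨N, hN⟩ := hq.exists_hom_from_TLe_eq_zero X
  obtain ⟨N', hN'⟩ := hq.exists_hom_from_TLe_eq_zero (X⟦(1 : ℤ)⟧)
  refine ⟨max N N', fun q hq' C hC t p => ⟨?_, ?_⟩⟩
  · intro φ φ' h
    rw [← sub_eq_zero]
    have h0 : (φ - φ') ≫ t.h p = 0 := by
      rw [Preadditive.sub_comp, sub_eq_zero]
      exact h
    obtain ⟨ψ, hψ⟩ := Triangle.coyoneda_exact₃ _ (t.distinguished p) (φ - φ') h0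
    have : ψ = 0 := hN q (by lia) C hC ψ
    exact hψ.trans ((congrArg (· ≫ _) this).trans zero_comp)
  · intro φ
    obtain ⟨ψ, hψ⟩ := Triangle.coyoneda_exact₁ _ (t.distinguished p) φ
      (hN' q (by lia) C hC _)
    exact ⟨ψ, hψ.symm⟩

variable [IsTriangulated T] [P.IsTriangulated]

lemma toQuotient_bijective (hq : IsSMCQuadruple k P 𝕊 S) {X : T} (t : TruncationSystem S X)
    (Y : T) : Function.Bijective (t.toQuotient k P (hq.gt_mem_perfect t) Y) := by
  constructor
  · rw [injective_iff_map_eq_zero]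
    intro z hz
    obtain ⟨p, φ, rfl⟩ := HomColim.exists_ι Y _ z
    rw [t.toQuotient_ι k, Preadditive.IsIso.comp_right_eq_zero, ← P.trW.Q.map_zero,
      MorphismProperty.map_eq_iff_postcomp P.trW.Q P.trW] at hz
    obtain ⟨Z, s, hs, hφ⟩ := hz
    obtain ⟨N, hN⟩ := hq.exists_factor_of_trW s hs
    -- `Q φ = 0` means that some `s` with perfect cone kills `φ`; a long enough transition map
    -- factors through `s`, so it kills `φ` too.
    obtain ⟨b, hb⟩ := hN (max N p) (le_max_left _ _) _ (t.leSystem_mem _)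
      (t.leSystem.map (homOfLE (le_max_right N p)))
    rw [← HomColim.ι_comp_map Y t.leSystem (le_max_right N p), hb, ← Category.assoc, hφ,
      zero_comp, zero_comp, map_zero]
  · intro θ
    obtain ⟨φ, rfl⟩ := Localization.exists_leftFraction P.trW.Q P.trW θ
    obtain ⟨N, hN⟩ := hq.exists_factor_of_trW φ.s φ.hs
    -- With `θ = s⁻¹ f` and `g N = s ≫ b`, the class of `f ≫ b` represents `θ`.
    obtain ⟨b, hb⟩ := hN N le_rfl _ (t.leSystem_mem N) (t.toLeSystem N)
    refine ⟨HomColim.ι k Y t.leSystem N (φ.f ≫ b), ?_⟩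
    rw [t.toQuotient_ι k, Iso.comp_inv_eq, TruncationSystem.quotientIso_hom, hb, Functor.map_comp,
      Functor.map_comp, MorphismProperty.LeftFraction.map_comp_map_s_assoc]

/-- The isomorphism `colim_p T(Y, X_{≤ -p}) ≅ T/P (Y, X)`. -/
def homColimEquiv (hq : IsSMCQuadruple k P 𝕊 S) {X : T} (t : TruncationSystem S X) (Y : T) :
    HomColim k Y t.leSystem ≃ₗ[k] (P.trW.Q.obj Y ⟶ P.trW.Q.obj X) :=
  LinearEquiv.ofBijective _ (hq.toQuotient_bijective t Y)

lemma homColimEquiv_ι_comp (hq : IsSMCQuadruple k P 𝕊 S) {X : T} (t : TruncationSystem S X)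
    (Y : T) (p : ℕ) (φ : Y ⟶ t.leSystem.obj p) :
    hq.homColimEquiv t Y (HomColim.ι k Y t.leSystem p φ) ≫ P.trW.Q.map (t.toLeSystem p) =
      P.trW.Q.map φ := by
  change t.toQuotient k P (hq.gt_mem_perfect t) Y _ ≫ _ = _
  rw [t.toQuotient_ι k, ← t.quotientIso_hom P (hq.gt_mem_perfect t) p, Category.assoc,
    Iso.inv_hom_id, Category.comp_id]

/-- The map `T/P (Y, X) → colim_p T(Y_{≤ -q}, Σ X_{> -p})`. -/
def quotientToHomColim (hq : IsSMCQuadruple k P 𝕊 S) {X Y : T} (s : TruncationSystem S Y)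
    (t : TruncationSystem S X) (q : ℕ) :
    (P.trW.Q.obj Y ⟶ P.trW.Q.obj X) →ₗ[k] HomColim k (s.leSystem.obj q) t.shiftGtSystem :=
  HomColim.postcomp k (s.leSystem.obj q) t.hNatTrans ∘ₗ
    (hq.homColimEquiv t (s.leSystem.obj q)).symm.toLinearMap ∘ₗ
      Linear.leftComp k _ (s.quotientIso P (hq.gt_mem_perfect s) q).inv

lemma quotientToHomColim_apply (hq : IsSMCQuadruple k P 𝕊 S) {X Y : T} (s : TruncationSystem S Y)
    (t : TruncationSystem S X) (q : ℕ) (θ : P.trW.Q.obj Y ⟶ P.trW.Q.obj X) :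
    hq.quotientToHomColim s t q θ = HomColim.postcomp k (s.leSystem.obj q) t.hNatTrans
      ((hq.homColimEquiv t (s.leSystem.obj q)).symm
        ((s.quotientIso P (hq.gt_mem_perfect s) q).inv ≫ θ)) := rfl

lemma precomp_quotientToHomColim (hq : IsSMCQuadruple k P 𝕊 S) {X Y : T}
    (s : TruncationSystem S Y) (t : TruncationSystem S X) {i j : ℕ} (hij : i ≤ j)
    (θ : P.trW.Q.obj Y ⟶ P.trW.Q.obj X) :
    HomColim.precomp k (s.leSystem.map (homOfLE hij)) t.shiftGtSystem
      (hq.quotientToHomColim s t j θ) = hq.quotientToHomColim s t i θ := by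
  rw [quotientToHomColim_apply, quotientToHomColim_apply]
  rw [HomColim.precomp_postcomp]
  congr 1
  rw [LinearEquiv.eq_symm_apply]
  refine (t.toQuotient_precomp k P (hq.gt_mem_perfect t) _ _).trans ?_
  rw [Iso.eq_inv_comp, TruncationSystem.quotientIso_hom, ← Category.assoc, ← Functor.map_comp,
    s.toLeSystem_map, ← s.quotientIso_hom P (hq.gt_mem_perfect s) j, ← Iso.eq_inv_comp]
  exact (hq.homColimEquiv t (s.leSystem.obj j)).apply_symm_apply _

lemma exists_quotientToHomColim_bijective (hq : IsSMCQuadruple k P 𝕊 S) {X Y : T}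
    (s : TruncationSystem S Y) (t : TruncationSystem S X) :
    ∃ N : ℕ, ∀ q : ℕ, N ≤ q → Function.Bijective (hq.quotientToHomColim s t q) := by
  obtain ⟨N, hN⟩ := hq.exists_comp_h_bijective X
  refine ⟨N, fun q h => (HomColim.postcomp_bijective _ t.hNatTrans
    (hN q h _ (s.leSystem_mem q) t)).comp
    ((hq.homColimEquiv t (s.leSystem.obj q)).symm.bijective.comp ?_)⟩
  exact ((s.quotientIso P (hq.gt_mem_perfect s) q).homFromEquiv).bijective

/-- The map `T/P (Y, X) → lim_q colim_p T(Y_{≤ -q}, Σ X_{> -p})`. -/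
def quotientToHomLimColim (hq : IsSMCQuadruple k P 𝕊 S) {X Y : T} (s : TruncationSystem S Y)
    (t : TruncationSystem S X) :
    (P.trW.Q.obj Y ⟶ P.trW.Q.obj X) →ₗ[k] HomLimColim k s.leSystem t.shiftGtSystem :=
  (LinearMap.pi (hq.quotientToHomColim s t)).codRestrict _
    fun θ _ _ hij => hq.precomp_quotientToHomColim s t hij θ

lemma quotientToHomLimColim_bijective (hq : IsSMCQuadruple k P 𝕊 S) {X Y : T}
    (s : TruncationSystem S Y) (t : TruncationSystem S X) :
    Function.Bijective (hq.quotientToHomLimColim s t) := by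
  obtain ⟨N, hN⟩ := hq.exists_quotientToHomColim_bijective s t
  constructor
  · intro θ θ' h
    exact (hN N le_rfl).1 (congrFun (congrArg Subtype.val h) N)
  · intro x
    obtain ⟨θ, hθ⟩ := (hN N le_rfl).2 (x.1 N)
    have key : ∀ q, N ≤ q → hq.quotientToHomColim s t q θ = x.1 q := by
      intro q hNq
      obtain ⟨θ', hθ'⟩ := (hN q hNq).2 (x.1 q)
      suffices θ' = θ by rw [← this, hθ']
      apply (hN N le_rfl).1
      rw [hθ, ← hq.precomp_quotientToHomColim s t hNq, hθ']
      exact x.2 N q hNq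
    refine ⟨θ, Subtype.ext (funext fun q => ?_)⟩
    change hq.quotientToHomColim s t q θ = x.1 q
    -- Components below `N` are determined by compatibility with the one at `max N q`.
    rw [← hq.precomp_quotientToHomColim s t (le_max_right N q), key _ (le_max_left N q)]
    exact x.2 _ _ _

lemma quotientToHomColim_eq (hq : IsSMCQuadruple k P 𝕊 S) {X Y : T}
    (s : TruncationSystem S Y) (t : TruncationSystem S X) (p q : ℕ)
    (ψ : s.leSystem.obj q ⟶ t.leSystem.obj p)
    (θ : P.trW.Q.obj Y ⟶ P.trW.Q.obj X)
    (h : θ ≫ P.trW.Q.map (t.toLeSystem p) = P.trW.Q.map (s.toLeSystem q ≫ ψ)) :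
    hq.quotientToHomColim s t q θ =
      HomColim.ι k (s.leSystem.obj q) t.shiftGtSystem p (ψ ≫ t.hNatTrans.app p) := by
  have : (hq.homColimEquiv t (s.leSystem.obj q)).symm
      ((s.quotientIso P (hq.gt_mem_perfect s) q).inv ≫ θ) =
      HomColim.ι k (s.leSystem.obj q) t.leSystem p ψ := by
    rw [LinearEquiv.symm_apply_eq, Iso.inv_comp_eq, TruncationSystem.quotientIso_hom,
      ← cancel_mono (t.quotientIso P (hq.gt_mem_perfect t) p).hom,
      TruncationSystem.quotientIso_hom, h, Category.assoc, hq.homColimEquiv_ι_comp,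
      Functor.map_comp]
  rw [quotientToHomColim_apply, this, HomColim.postcomp_ι]

end IsSMCQuadruple

end Main

end SMCQuadruple

end

theorem theorem3p8 {k : Type*} [Field k] {T : Type*} [Category T] [Preadditive T] [Linear k T]
    [HasZeroObject T] [HasShift T ℤ] [∀ n : ℤ, (shiftFunctor T n).Additive]
    [∀ n : ℤ, (shiftFunctor T n).Linear k] [Pretriangulated T] [IsTriangulated T]
    (P : ObjectProperty T) [P.IsTriangulated] (𝕊 : T ⥤ T) [𝕊.CommShift ℤ] (S : ObjectProperty T)
    (hquad : SMCQuadruple.IsSMCQuadruple k P 𝕊 S) (X Y : T) :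
    -- the direct systems stabilize, for every choice of truncation triangles
    (∃ N : ℕ, ∀ (t : SMCQuadruple.TruncationSystem S X) (p : ℕ), N ≤ p →
      Function.Bijective (fun φ : Y ⟶ t.le p => φ ≫ t.ξ p)) ∧
    -- the colimit is canonically the Hom-space of the Verdier quotient
    (∀ t : SMCQuadruple.TruncationSystem S X,
      ∃ e : SMCQuadruple.HomColim k Y t.leSystem ≃ₗ[k] (P.trW.Q.obj Y ⟶ P.trW.Q.obj X),
        ∀ (p : ℕ) (φ : Y ⟶ t.le p),
          e (SMCQuadruple.HomColim.ι k Y t.leSystem p φ) ≫ P.trW.Q.map (t.g p) =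
            P.trW.Q.map φ) ∧
    -- the limit of the colimits is canonically the Hom-space of the Verdier quotient
    (∀ (s : SMCQuadruple.TruncationSystem S Y) (t : SMCQuadruple.TruncationSystem S X),
      ∃ e : (P.trW.Q.obj Y ⟶ P.trW.Q.obj X) ≃ₗ[k]
          SMCQuadruple.HomLimColim k s.leSystem t.shiftGtSystem,
        ∀ (p q : ℕ) (ψ : s.le q ⟶ t.le p) (φ : P.trW.Q.obj Y ⟶ P.trW.Q.obj X),
          φ ≫ P.trW.Q.map (t.g p) = P.trW.Q.map (s.g q ≫ ψ) →
            (e φ).1 q =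
              SMCQuadruple.HomColim.ι k (s.le q) t.shiftGtSystem p (ψ ≫ t.h p)) := by
  refine ⟨hquad.exists_bijective_ξ X Y, fun t => ⟨hquad.homColimEquiv t Y, ?_⟩, fun s t =>
    ⟨LinearEquiv.ofBijective _ (hquad.quotientToHomLimColim_bijective s t), ?_⟩⟩
  · exact hquad.homColimEquiv_ι_comp t Y
  · exact hquad.quotientToHomColim_eq s t
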